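/- There is an absolute constant $C>0$ such that the following holds. Let $N\ge 2$, and let $\Sigma_N$ be an arbitrary set of $N$ unit vectors in $\mathbb{R}^2$. For $f\in L^2(\mathbb{R}^2)$ (complex valued) define the single scale Kakeya maximal operator $$M_N^0f(x)=\sup_{v\in\Sigma_N}\Big|\int_{|t|<1}f(x+tv)\,dt\Big|,\qquad x\in\mathbb{R}^2.$$ Then, for almost every $x$, all the integrals in this supremum converge absolutely; moreover $M_N^0f\in L^2(\mathbb{R}^2)$ and $$\|M_N^0f\|_{L^2(\mathbb{R}^2)}\le C\sqrt{\log N}\,\|f\|_{L^2(\mathbb{R}^2)}.$$ In other words, $\|M_N^0\|_{2\to2}\lesssim\sqrt{\log N}$, with an implied constant independent of $N$ and of the choice of $\Sigma_N$. -/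

import Mathlib

open MeasureTheory

noncomputable section

/-- The single scale Kakeya operator attached to a finite set `S` of vectors in the plane:
`M f (x) = sup_{v ∈ S} |∫_{|t| < 1} f (x + t v) dt|`. -/
def singleScaleKakeya (S : Finset (EuclideanSpace ℝ (Fin 2)))
    (f : EuclideanSpace ℝ (Fin 2) → ℂ) (x : EuclideanSpace ℝ (Fin 2)) : ℝ :=
  ⨆ v : {v : EuclideanSpace ℝ (Fin 2) // v ∈ S},
    ‖∫ t in Set.Ioo (-1 : ℝ) 1, f (x + t • (v : EuclideanSpace ℝ (Fin 2)))‖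

end

/-! By duality, the maximal bound follows from `lintegral_sum_lineAvg_sq_le`. Write A_v for the
average over a segment of slope v. For nonnegative h_v and at most 2^n slopes, ‖Σ A_v h_v‖² ≲ (n +
1) ‖Σ h_v‖² in L². The proof bisects the set of slopes. Squares are superadditive on nonnegative
functions, so the two halves together cost no more than one set of half the size, and each bisection
only adds a cross term. The theorem thus reduces to bounding that term by a constant multiple of ‖Σ
h_v‖², which is `lintegral_sum_mul_sum_le`.

For v < m < w, the composition A_w A_v averages over a parallelogram. It is dominated by a segment
average of the fixed slope m composed with a Poisson average along e', at the scale max(m - v, w -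
m) (`lineAvg_comp_le`). This scale depends on only one of the two slopes, so the double sum over v
and w decouples.

What remains is one-dimensional: F = Σ P_{r_i} a_i satisfies ‖F‖ ≲ ‖Σ a_i‖
(`lintegral_sum_poisson_sq_le`). Since P_ρ P_r ≲ P_r for ρ ≤ r, expanding the square gives ‖F‖² ≲ ⟨Σ
a_i, F⟩, and F is absorbed. -/

open scoped ENNReal

/-! ### Weighted averages along lines: L² bound and self-adjointness. -/

section LineAverages

variable {E : Type*} [NormedAddCommGroup E] [NormedSpace ℝ E] [MeasurableSpace E] [BorelSpace E]
  [SecondCountableTopology E]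

/-- The weighted average of `g` over the line through `x` in direction `e`, with weight `w`. -/
noncomputable def lineAvg (w : ℝ → ℝ≥0∞) (e : E) (g : E → ℝ≥0∞) (x : E) : ℝ≥0∞ :=
  ∫⁻ t, w t * g (x + t • e)

theorem ENNReal.mul_le_sq_add_sq (a b : ℝ≥0∞) : a * b ≤ a ^ 2 + b ^ 2 := by
  rcases le_total a b with h | h
  · calc a * b ≤ b * b := by gcongr
      _ = b ^ 2 := (sq b).symm
      _ ≤ _ := le_add_self
  · calc a * b ≤ a * a := by gcongr
      _ = a ^ 2 := (sq a).symm
      _ ≤ _ := le_self_add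

theorem measurable_lineAvg {w : ℝ → ℝ≥0∞} (hw : Measurable w) (e : E) {g : E → ℝ≥0∞}
    (hg : Measurable g) : Measurable (lineAvg w e g) := by
  unfold lineAvg
  apply Measurable.lintegral_prod_right'
    (f := fun p : E × ℝ => w p.2 * g (p.1 + p.2 • e))
  fun_prop

theorem lineAvg_finset_sum {ι : Type*} {w : ℝ → ℝ≥0∞} (hw : Measurable w) (e : E) (s : Finset ι)
    {g : ι → E → ℝ≥0∞} (hg : ∀ i, Measurable (g i)) (x : E) :
    lineAvg w e (fun y => ∑ i ∈ s, g i y) x = ∑ i ∈ s, lineAvg w e (g i) x := by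
  unfold lineAvg
  rw [← lintegral_finsetSum s (fun i _ => by have := hg i; fun_prop)]
  simp only [Finset.mul_sum]

theorem lineAvg_comm {w w' : ℝ → ℝ≥0∞} (hw : Measurable w) (hw' : Measurable w') (e e' : E)
    {g : E → ℝ≥0∞} (hg : Measurable g) (x : E) :
    lineAvg w e (lineAvg w' e' g) x = lineAvg w' e' (lineAvg w e g) x := by
  unfold lineAvg
  calc ∫⁻ t, w t * ∫⁻ s, w' s * g (x + t • e + s • e')
      = ∫⁻ t, ∫⁻ s, w t * (w' s * g (x + t • e + s • e')) :=
        lintegral_congr fun t => (lintegral_const_mul _ (by fun_prop)).symm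
    _ = ∫⁻ s, ∫⁻ t, w t * (w' s * g (x + t • e + s • e')) :=
        lintegral_lintegral_swap (by fun_prop)
    _ = ∫⁻ s, w' s * ∫⁻ t, w t * g (x + s • e' + t • e) := by
        refine lintegral_congr fun s => ?_
        rw [← lintegral_const_mul _ (by fun_prop)]
        refine lintegral_congr fun t => ?_
        rw [add_right_comm, mul_left_comm]

variable {μ : Measure E} [SFinite μ] [μ.IsAddRightInvariant]

/-- Using `ENNReal.mul_le_sq_add_sq` in place of Cauchy–Schwarz costs only the factor 2. -/
theorem lintegral_lineAvg_sq_le {w : ℝ → ℝ≥0∞} (hw : Measurable w) (e : E) {g : E → ℝ≥0∞}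
    (hg : Measurable g) :
    ∫⁻ x, lineAvg w e g x ^ 2 ∂μ ≤ 2 * (∫⁻ t, w t) ^ 2 * ∫⁻ x, g x ^ 2 ∂μ := by
  have key : ∀ x, lineAvg w e g x ^ 2 ≤
      2 * (∫⁻ t, w t) * ∫⁻ t, w t * g (x + t • e) ^ 2 := by
    intro x
    calc lineAvg w e g x ^ 2
        = ∫⁻ t, ∫⁻ s, w t * g (x + t • e) * (w s * g (x + s • e)) := by
          rw [sq, lineAvg, ← lintegral_mul_const _ (by fun_prop)]
          refine lintegral_congr fun t => (lintegral_const_mul _ (by fun_prop)).symm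
      _ ≤ ∫⁻ t, ∫⁻ s, (w t * g (x + t • e) ^ 2 * w s + w t * (w s * g (x + s • e) ^ 2)) := by
          refine lintegral_mono fun t => lintegral_mono fun s => ?_
          calc w t * g (x + t • e) * (w s * g (x + s • e))
              = w t * w s * (g (x + t • e) * g (x + s • e)) := by ring
            _ ≤ w t * w s * (g (x + t • e) ^ 2 + g (x + s • e) ^ 2) := by
                gcongr; exact ENNReal.mul_le_sq_add_sq _ _
            _ = _ := by ring
      _ = _ := by
          have : ∀ t, ∫⁻ s, (w t * g (x + t • e) ^ 2 * w s + w t * (w s * g (x + s • e) ^ 2))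
              = w t * g (x + t • e) ^ 2 * (∫⁻ s, w s)
                + w t * ∫⁻ s, w s * g (x + s • e) ^ 2 := by
            intro t
            rw [lintegral_add_left (by fun_prop), lintegral_const_mul _ (by fun_prop),
              lintegral_const_mul _ (by fun_prop)]
          simp only [this]
          rw [lintegral_add_left (by fun_prop), lintegral_mul_const _ (by fun_prop),
            lintegral_mul_const _ (by fun_prop)]
          ring
  calc ∫⁻ x, lineAvg w e g x ^ 2 ∂μ
      ≤ ∫⁻ x, 2 * (∫⁻ t, w t) * (∫⁻ t, w t * g (x + t • e) ^ 2) ∂μ := lintegral_mono key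
    _ = 2 * (∫⁻ t, w t) * ∫⁻ t, (∫⁻ x, w t * g (x + t • e) ^ 2 ∂μ) := by
        rw [lintegral_const_mul, lintegral_lintegral_swap (by fun_prop)]
        apply Measurable.lintegral_prod_right'
          (f := fun p : E × ℝ => w p.2 * g (p.1 + p.2 • e) ^ 2)
        fun_prop
    _ = 2 * (∫⁻ t, w t) * ∫⁻ t, w t * (∫⁻ x, g x ^ 2 ∂μ) := by
        congr 1
        refine lintegral_congr fun t => ?_
        rw [lintegral_const_mul _ (by fun_prop),
          lintegral_add_right_eq_self (fun x => g x ^ 2) (t • e)]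
    _ = _ := by rw [lintegral_mul_const _ hw]; ring

theorem lintegral_lineAvg_mul {w : ℝ → ℝ≥0∞} (hw : Measurable w) (hev : ∀ t, w (-t) = w t)
    (e : E) {g h : E → ℝ≥0∞} (hg : Measurable g) (hh : Measurable h) :
    ∫⁻ x, lineAvg w e g x * h x ∂μ = ∫⁻ x, g x * lineAvg w e h x ∂μ := by
  calc ∫⁻ x, lineAvg w e g x * h x ∂μ
      = ∫⁻ x, (∫⁻ t, w t * g (x + t • e) * h x) ∂μ :=
        lintegral_congr fun x => (lintegral_mul_const _ (by fun_prop)).symm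
    _ = ∫⁻ t, (∫⁻ x, w t * g (x + t • e) * h x ∂μ) := lintegral_lintegral_swap (by fun_prop)
    _ = ∫⁻ t, (∫⁻ x, w t * g x * h (x + (-t) • e) ∂μ) := by
        refine lintegral_congr fun t => ?_
        rw [← lintegral_add_right_eq_self (fun x => w t * g x * h (x + (-t) • e)) (t • e)]
        simp
    _ = ∫⁻ t, (∫⁻ x, w t * g x * h (x + t • e) ∂μ) := by
        rw [← lintegral_neg_eq_self]
        simp [hev]
    _ = ∫⁻ x, (∫⁻ t, w t * g x * h (x + t • e)) ∂μ := lintegral_lintegral_swap (by fun_prop)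
    _ = _ := by
        refine lintegral_congr fun x => ?_
        rw [lineAvg, ← lintegral_const_mul _ (by fun_prop)]
        refine lintegral_congr fun t => by ring

/-! ### Poisson averages along parallel lines. -/

/-- The Poisson kernel `r / (r² + q²)` of the line, without the factor `1 / π`. -/
noncomputable def poissonWeight (r q : ℝ) : ℝ≥0∞ := ENNReal.ofReal (r / (r ^ 2 + q ^ 2))

theorem measurable_poissonWeight (r : ℝ) : Measurable (poissonWeight r) := by
  unfold poissonWeight; fun_prop

theorem poissonWeight_neg (r q : ℝ) : poissonWeight r (-q) = poissonWeight r q := by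
  simp [poissonWeight]

theorem lintegral_comp_affine {d : ℝ} (hd : 0 < d) (c : ℝ) (ψ : ℝ → ℝ≥0∞) :
    ∫⁻ s, ENNReal.ofReal d * ψ (c + s * d) = ∫⁻ q, ψ q := by
  rw [lintegral_const_mul' _ _ ENNReal.ofReal_ne_top]
  have h := lintegral_map_equiv (μ := (volume : Measure ℝ)) (fun q => ψ (c + q))
    (MeasurableEquiv.mulRight₀ d hd.ne')
  simp only [MeasurableEquiv.coe_mulRight₀] at h
  rw [← h, Real.map_volume_mul_right hd.ne', lintegral_smul_measure, abs_of_pos (inv_pos.2 hd),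
    smul_eq_mul, ← mul_assoc, ← ENNReal.ofReal_mul hd.le, mul_inv_cancel₀ hd.ne',
    lintegral_add_left_eq_self ψ c]
  simp

theorem lintegral_poissonWeight_le {r : ℝ} (hr : 0 < r) : ∫⁻ q, poissonWeight r q ≤ 4 := by
  rw [← lintegral_comp_affine hr 0]
  have : ∀ s : ℝ, ENNReal.ofReal r * poissonWeight r (0 + s * r)
      = ENNReal.ofReal ((1 + s ^ 2)⁻¹) := by
    intro s
    rw [poissonWeight, ← ENNReal.ofReal_mul hr.le]
    congr 1
    have : 1 + s ^ 2 ≠ 0 := by positivity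
    field_simp
    ring
  simp only [this]
  rw [← ofReal_integral_eq_lintegral_ofReal integrable_inv_one_add_sq
    (ae_of_all _ fun s => by positivity), integral_univ_inv_one_add_sq]
  exact (ENNReal.ofReal_le_ofReal Real.pi_le_four).trans (by simp)

/-- One of |t|, |s - t| is at least |s| / 2, and the narrower kernel has the lighter tail; hence one
of the two factors is ≲ `poissonWeight r s`. After clearing denominators this is s² ≤ 2(s - t)² +
2t² combined with ρ ≤ r. -/
theorem poissonWeight_mul_le {r ρ : ℝ} (hρ : 0 < ρ) (hr : ρ ≤ r) (s t : ℝ) :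
    poissonWeight ρ t * poissonWeight r (s - t) ≤
      2 * poissonWeight r s * (poissonWeight ρ t + poissonWeight r (s - t)) := by
  have hr0 : 0 < r := hρ.trans_le hr
  unfold poissonWeight
  rw [← ENNReal.ofReal_add (by positivity) (by positivity), ← ENNReal.ofReal_mul (by positivity),
    ← ENNReal.ofReal_ofNat 2, ← ENNReal.ofReal_mul (by positivity),
    ← ENNReal.ofReal_mul (by positivity)]
  apply ENNReal.ofReal_le_ofReal
  have e : 2 * (r / (r ^ 2 + s ^ 2)) * (ρ / (ρ ^ 2 + t ^ 2) + r / (r ^ 2 + (s - t) ^ 2))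
      = 2 * r * (ρ * (r ^ 2 + (s - t) ^ 2) + r * (ρ ^ 2 + t ^ 2)) /
        ((r ^ 2 + s ^ 2) * ((ρ ^ 2 + t ^ 2) * (r ^ 2 + (s - t) ^ 2))) := by
    field_simp
  rw [e, div_mul_div_comm, div_le_div_iff₀ (by positivity) (by positivity)]
  have h1 : ρ * r * (r ^ 2 + s ^ 2) ≤
      2 * r * (ρ * (r ^ 2 + (s - t) ^ 2) + r * (ρ ^ 2 + t ^ 2)) := by
    have h2 : ρ * (r ^ 2 + s ^ 2) ≤ 2 * (ρ * (r ^ 2 + (s - t) ^ 2) + r * (ρ ^ 2 + t ^ 2)) := by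
      have : s ^ 2 ≤ 2 * (s - t) ^ 2 + 2 * t ^ 2 := by nlinarith [sq_nonneg (s - 2 * t)]
      have h3 : ρ * s ^ 2 ≤ ρ * (2 * (s - t) ^ 2 + 2 * t ^ 2) := by gcongr
      have h4 : ρ * t ^ 2 ≤ r * t ^ 2 := by gcongr
      have h5 : 0 ≤ ρ * r ^ 2 := by positivity
      have h6 : 0 ≤ r * ρ ^ 2 := by positivity
      nlinarith
    nlinarith
  calc _ = ρ * r * (r ^ 2 + s ^ 2) * ((ρ ^ 2 + t ^ 2) * (r ^ 2 + (s - t) ^ 2)) := by ring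
    _ ≤ _ := by gcongr

/-- A crude substitute for the semigroup law: the wider average absorbs the narrower one. The
constant is 2(4 + 4), each kernel having mass π ≤ 4. -/
theorem lineAvg_poissonWeight_comp_le {r ρ : ℝ} (hρ : 0 < ρ) (hr : ρ ≤ r) (e : E)
    {g : E → ℝ≥0∞} (hg : Measurable g) (x : E) :
    lineAvg (poissonWeight ρ) e (lineAvg (poissonWeight r) e g) x ≤
      16 * lineAvg (poissonWeight r) e g x := by
  have mr := measurable_poissonWeight r
  have mρ := measurable_poissonWeight ρ
  calc lineAvg (poissonWeight ρ) e (lineAvg (poissonWeight r) e g) x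
      = ∫⁻ t, ∫⁻ s, poissonWeight ρ t * (poissonWeight r (s - t) * g (x + s • e)) := by
        refine lintegral_congr fun t => ?_
        rw [lintegral_const_mul _ (by fun_prop), lineAvg,
          ← lintegral_sub_right_eq_self (fun q => poissonWeight r q * g (x + t • e + q • e)) t]
        congr 1
        refine lintegral_congr fun s => ?_
        congr 2
        module
    _ ≤ ∫⁻ t, ∫⁻ s, 2 * (poissonWeight r s * g (x + s • e)) *
          (poissonWeight ρ t + poissonWeight r (s - t)) := by
        refine lintegral_mono fun t => lintegral_mono fun s => ?_
        calc _ = poissonWeight ρ t * poissonWeight r (s - t) * g (x + s • e) := by ring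
          _ ≤ 2 * poissonWeight r s * (poissonWeight ρ t + poissonWeight r (s - t))
              * g (x + s • e) := mul_le_mul_left (poissonWeight_mul_le hρ hr s t) _
          _ = _ := by ring
    _ = ∫⁻ s, ∫⁻ t, 2 * (poissonWeight r s * g (x + s • e)) *
          (poissonWeight ρ t + poissonWeight r (s - t)) := lintegral_lintegral_swap (by fun_prop)
    _ ≤ ∫⁻ s, 2 * (poissonWeight r s * g (x + s • e)) * (4 + 4) := by
        refine lintegral_mono fun s => ?_
        rw [lintegral_const_mul _ (by fun_prop), lintegral_add_left (by fun_prop),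
          lintegral_sub_left_eq_self (poissonWeight r) s]
        gcongr
        · exact lintegral_poissonWeight_le hρ
        · exact lintegral_poissonWeight_le (hρ.trans_le hr)
    _ = _ := by
        rw [lineAvg, ← lintegral_const_mul _ (by fun_prop)]
        refine lintegral_congr fun s => by ring

/-- A vector-valued form of the `L²` maximal theorem for Poisson averages along parallel lines. -/
theorem lintegral_sum_poisson_sq_le {ι : Type*} (s : Finset ι) {r : ι → ℝ} (hr : ∀ i ∈ s, 0 < r i)
    (e : E) {a : ι → E → ℝ≥0∞} (ha : ∀ i, Measurable (a i)) :
    ∫⁻ x, (∑ i ∈ s, lineAvg (poissonWeight (r i)) e (a i) x) ^ 2 ∂μ ≤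
      4096 * ∫⁻ x, (∑ i ∈ s, a i x) ^ 2 ∂μ := by
  set R : ι → E → ℝ≥0∞ := fun i => lineAvg (poissonWeight (r i)) e (a i) with hR
  have mR : ∀ i, Measurable (R i) := fun i =>
    measurable_lineAvg (measurable_poissonWeight _) e (ha i)
  set F : E → ℝ≥0∞ := fun x => ∑ i ∈ s, R i x with hF
  set A : E → ℝ≥0∞ := fun x => ∑ i ∈ s, a i x with hA
  have mF : Measurable F := by fun_prop
  have mA : Measurable A := by fun_prop
  change ∫⁻ x, F x ^ 2 ∂μ ≤ 4096 * ∫⁻ x, A x ^ 2 ∂μ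
  rcases eq_or_ne (∫⁻ x, A x ^ 2 ∂μ) ∞ with hinf | hfin
  · simp [hinf]
  have pair : ∀ i ∈ s, ∀ j ∈ s, ∫⁻ x, R i x * R j x ∂μ ≤
      ∫⁻ x, 16 * (a j x * R i x + a i x * R j x) ∂μ := by
    -- Self-adjointness moves the narrower average onto the wider one, which absorbs it.
    have one : ∀ i ∈ s, ∀ j ∈ s, r j ≤ r i → ∫⁻ x, R j x * R i x ∂μ ≤
        ∫⁻ x, 16 * (a j x * R i x) ∂μ := by
      intro i hi j hj hij
      rw [lintegral_lineAvg_mul (measurable_poissonWeight _) (poissonWeight_neg _) e (ha j) (mR i)]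
      refine lintegral_mono fun x => ?_
      calc _ ≤ a j x * (16 * R i x) := by
            gcongr; exact lineAvg_poissonWeight_comp_le (hr j hj) hij e (ha i) x
        _ = _ := by ring
    intro i hi j hj
    rcases le_total (r j) (r i) with h | h
    · calc _ = ∫⁻ x, R j x * R i x ∂μ := by simp only [mul_comm]
        _ ≤ _ := one i hi j hj h
        _ ≤ _ := lintegral_mono fun x => by gcongr; exact le_self_add
    · exact (one j hj i hi h).trans (lintegral_mono fun x => by gcongr; exact le_add_self)
  have main : ∫⁻ x, F x ^ 2 ∂μ ≤ ∫⁻ x, 32 * (A x * F x) ∂μ := by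
    calc ∫⁻ x, F x ^ 2 ∂μ = ∑ i ∈ s, ∑ j ∈ s, ∫⁻ x, R i x * R j x ∂μ := by
          simp only [hF, sq, Finset.sum_mul_sum]
          rw [lintegral_finsetSum _ (fun i _ => by fun_prop)]
          refine Finset.sum_congr rfl fun i _ => ?_
          rw [lintegral_finsetSum _ (fun i _ => by fun_prop)]
      _ ≤ ∑ i ∈ s, ∑ j ∈ s, ∫⁻ x, 16 * (a j x * R i x + a i x * R j x) ∂μ :=
          Finset.sum_le_sum fun i hi => Finset.sum_le_sum fun j hj => pair i hi j hj
      _ = ∫⁻ x, ∑ i ∈ s, ∑ j ∈ s, 16 * (a j x * R i x + a i x * R j x) ∂μ := by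
          rw [lintegral_finsetSum _ (fun i _ => by fun_prop)]
          refine Finset.sum_congr rfl fun i _ => ?_
          rw [lintegral_finsetSum _ (fun i _ => by fun_prop)]
      _ = _ := by
          refine lintegral_congr fun x => ?_
          have h1 : ∑ i ∈ s, ∑ j ∈ s, a j x * R i x = A x * F x := by
            rw [Finset.sum_comm, Finset.sum_mul_sum]
          have h2 : ∑ i ∈ s, ∑ j ∈ s, a i x * R j x = A x * F x := by
            rw [Finset.sum_mul_sum]
          have h3 (u : ι → ι → ℝ≥0∞) :
              ∑ i ∈ s, ∑ j ∈ s, 16 * u i j = 16 * ∑ i ∈ s, ∑ j ∈ s, u i j := by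
            simp only [Finset.mul_sum]
          rw [h3 fun i j => a j x * R i x + a i x * R j x]
          simp only [Finset.sum_add_distrib, h1, h2]
          ring
  -- A qualitative bound, not uniform in `s`, needed only to cancel one copy of ∫ F² at the end.
  have fin : ∫⁻ x, F x ^ 2 ∂μ ≠ ∞ := by
    have hRm : ∀ i ∈ s, MemLp (fun x => (R i x)) 2 μ := by
      intro i hi
      refine ⟨(mR i).aestronglyMeasurable, ?_⟩
      have : ∫⁻ x, R i x ^ 2 ∂μ < ∞ := by
        refine (lintegral_lineAvg_sq_le (measurable_poissonWeight _) e (ha i)).trans_lt ?_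
        refine ENNReal.mul_lt_top ?_ ?_
        · refine ENNReal.mul_lt_top (by simp) (ENNReal.pow_lt_top ?_)
          exact (lintegral_poissonWeight_le (hr i hi)).trans_lt (by simp)
        · refine lt_of_le_of_lt (lintegral_mono fun x => ?_) hfin.lt_top
          gcongr
          exact Finset.single_le_sum (f := fun i => a i x) (fun _ _ => zero_le) hi
      rw [eLpNorm_lt_top_iff_lintegral_rpow_enorm_lt_top (by simp) (by simp)]
      simpa using this
    have := memLp_finsetSum s hRm
    have := (eLpNorm_lt_top_iff_lintegral_rpow_enorm_lt_top (by simp) (by simp)).1 this.2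
    simpa [hF] using this.ne
  have two : 2 * ∫⁻ x, F x ^ 2 ∂μ ≤ ∫⁻ x, F x ^ 2 ∂μ + 4096 * ∫⁻ x, A x ^ 2 ∂μ := by
    calc 2 * ∫⁻ x, F x ^ 2 ∂μ ≤ 2 * ∫⁻ x, 32 * (A x * F x) ∂μ := by gcongr
      _ = ∫⁻ x, 64 * (A x * F x) ∂μ := by
          rw [← lintegral_const_mul _ (by fun_prop)]
          refine lintegral_congr fun x => by ring
      _ ≤ ∫⁻ x, (F x ^ 2 + 4096 * A x ^ 2) ∂μ := by
          refine lintegral_mono fun x => ?_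
          calc 64 * (A x * F x) = (64 * A x) * F x := by ring
            _ ≤ (64 * A x) ^ 2 + F x ^ 2 := ENNReal.mul_le_sq_add_sq _ _
            _ = _ := by ring
      _ = _ := by rw [lintegral_add_left (by fun_prop), lintegral_const_mul _ (by fun_prop)]
  rw [two_mul] at two
  exact (ENNReal.add_le_add_iff_left fin).1 two

end LineAverages

/-! ### Unit segments in directions e + v e', and the interaction across a slope m. -/

section Directions

variable {E : Type*} [NormedAddCommGroup E] [NormedSpace ℝ E] [MeasurableSpace E] [BorelSpace E]
  [SecondCountableTopology E]

/-- The indicator function of the interval `(-ℓ, ℓ)`. -/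
noncomputable def segmentWeight (ℓ : ℝ) : ℝ → ℝ≥0∞ := (Set.Ioo (-ℓ) ℓ).indicator 1

theorem measurable_segmentWeight (ℓ : ℝ) : Measurable (segmentWeight ℓ) :=
  measurable_one.indicator measurableSet_Ioo

theorem segmentWeight_neg (ℓ t : ℝ) : segmentWeight ℓ (-t) = segmentWeight ℓ t := by
  have : -t ∈ Set.Ioo (-ℓ) ℓ ↔ t ∈ Set.Ioo (-ℓ) ℓ := by
    simp only [Set.mem_Ioo]; constructor <;> rintro ⟨h, h'⟩ <;> constructor <;> linarith
  by_cases h : t ∈ Set.Ioo (-ℓ) ℓ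
  · simp [segmentWeight, h, this.2 h]
  · simp [segmentWeight, h, mt this.1 h]

theorem lintegral_segmentWeight (ℓ : ℝ) : ∫⁻ t, segmentWeight ℓ t = ENNReal.ofReal (2 * ℓ) := by
  rw [segmentWeight, lintegral_indicator_one measurableSet_Ioo, Real.volume_Ioo]
  congr 1; ring

theorem lintegral_lineAvg_segmentWeight_one_sq_le {μ : Measure E} [SFinite μ]
    [μ.IsAddRightInvariant] (e : E) {g : E → ℝ≥0∞} (hg : Measurable g) :
    ∫⁻ x, lineAvg (segmentWeight 1) e g x ^ 2 ∂μ ≤ 8 * ∫⁻ x, g x ^ 2 ∂μ := by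
  refine (lintegral_lineAvg_sq_le (measurable_segmentWeight 1) e hg).trans_eq ?_
  rw [lintegral_segmentWeight]
  norm_num

theorem lintegral_lineAvg_segmentWeight_two_sq_le {μ : Measure E} [SFinite μ]
    [μ.IsAddRightInvariant] (e : E) {g : E → ℝ≥0∞} (hg : Measurable g) :
    ∫⁻ x, lineAvg (segmentWeight 2) e g x ^ 2 ∂μ ≤ 32 * ∫⁻ x, g x ^ 2 ∂μ := by
  refine (lintegral_lineAvg_sq_le (measurable_segmentWeight 2) e hg).trans_eq ?_
  rw [lintegral_segmentWeight]
  norm_num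

/-- With t = p - s, the argument of the kernel is t(v - m) + s(w - m), of size at most w - v ≤ 2r.
So r² + q² ≤ 5r², and w - v ≥ r makes the right side at least 1 wherever the left side is nonzero.
-/
theorem segmentWeight_mul_le {v m w r : ℝ} (hv : v ≤ m) (hw : m ≤ w) (hr : 0 < r)
    (h1 : r ≤ w - v) (h2 : w - v ≤ 2 * r) (p s : ℝ) :
    segmentWeight 1 s * segmentWeight 1 (p - s) ≤ segmentWeight 2 p *
      (5 * (ENNReal.ofReal (w - v) * poissonWeight r (p * (v - m) + s * (w - v)))) := by
  by_cases hs : s ∈ Set.Ioo (-1 : ℝ) 1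
  swap
  · simp [segmentWeight, hs]
  by_cases ht : p - s ∈ Set.Ioo (-1 : ℝ) 1
  swap
  · simp [segmentWeight, ht]
  have hp : p ∈ Set.Ioo (-2 : ℝ) 2 := by
    simp only [Set.mem_Ioo] at *; constructor <;> linarith
  simp only [segmentWeight, hs, ht, hp, Set.indicator_of_mem, Pi.one_apply, one_mul]
  rw [poissonWeight, ← ENNReal.ofReal_mul (by linarith), ← ENNReal.ofReal_ofNat 5,
    ← ENNReal.ofReal_mul (by norm_num), ← ENNReal.ofReal_one]
  apply ENNReal.ofReal_le_ofReal
  set q := p * (v - m) + s * (w - v) with hq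
  have hq' : q = (p - s) * (v - m) + s * (w - m) := by rw [hq]; ring
  have hqa : q ^ 2 ≤ (2 * r) ^ 2 := by
    apply sq_le_sq'
    · nlinarith [hs.1, hs.2, ht.1, ht.2]
    · nlinarith [hs.1, hs.2, ht.1, ht.2]
  rw [← mul_div_assoc, ← mul_div_assoc, one_le_div (by positivity)]
  nlinarith

/-- A point s(e + w e') + t(e + v e') of the parallelogram equals p(e + m e') + q e' with p = s + t
and q = p(v - m) + s(w - v). For fixed p, the change of variable from s to q has Jacobian w - v. -/
theorem lineAvg_comp_le {v m w r : ℝ} (hv : v ≤ m) (hw : m ≤ w) (hr : 0 < r)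
    (h1 : r ≤ w - v) (h2 : w - v ≤ 2 * r) (e e' : E) {g : E → ℝ≥0∞} (hg : Measurable g) (x : E) :
    lineAvg (segmentWeight 1) (e + w • e') (lineAvg (segmentWeight 1) (e + v • e') g) x ≤
      5 * lineAvg (segmentWeight 2) (e + m • e') (lineAvg (poissonWeight r) e' g) x := by
  have m1 := measurable_segmentWeight 1
  have m2 := measurable_segmentWeight 2
  have mr := measurable_poissonWeight r
  have hd : 0 < w - v := hr.trans_le h1
  have mG : ∀ p : ℝ, Measurable fun q : ℝ => g (x + p • (e + m • e') + q • e') := by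
    intro p; fun_prop
  calc lineAvg (segmentWeight 1) (e + w • e') (lineAvg (segmentWeight 1) (e + v • e') g) x
      = ∫⁻ s, ∫⁻ p, segmentWeight 1 s * segmentWeight 1 (p - s) *
          g (x + p • (e + m • e') + (p * (v - m) + s * (w - v)) • e') := by
        refine lintegral_congr fun s => ?_
        rw [lineAvg, ← lintegral_const_mul _ (by fun_prop), ← lintegral_sub_right_eq_self _ s]
        refine lintegral_congr fun p => ?_
        rw [← mul_assoc]
        congr 2
        module
    _ = ∫⁻ p, ∫⁻ s, segmentWeight 1 s * segmentWeight 1 (p - s) *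
          g (x + p • (e + m • e') + (p * (v - m) + s * (w - v)) • e') :=
        lintegral_lintegral_swap (by fun_prop)
    _ ≤ ∫⁻ p, ∫⁻ s, 5 * segmentWeight 2 p * (ENNReal.ofReal (w - v) *
          (poissonWeight r (p * (v - m) + s * (w - v)) *
            g (x + p • (e + m • e') + (p * (v - m) + s * (w - v)) • e'))) := by
        refine lintegral_mono fun p => lintegral_mono fun s => ?_
        refine (mul_le_mul_left (segmentWeight_mul_le hv hw hr h1 h2 p s) _).trans_eq ?_
        ring
    _ = ∫⁻ p, 5 * segmentWeight 2 p * ∫⁻ q, poissonWeight r q *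
            g (x + p • (e + m • e') + q • e') := by
        refine lintegral_congr fun p => ?_
        rw [lintegral_const_mul _ (by fun_prop), lintegral_comp_affine hd _
          (fun q => poissonWeight r q * g (x + p • (e + m • e') + q • e'))]
    _ = _ := by
        unfold lineAvg
        rw [← lintegral_const_mul']
        · simp only [mul_assoc]
        · simp

variable {μ : Measure E} [SFinite μ] [μ.IsAddRightInvariant]

/-- Only the term with the larger of |v - m|, |w - m| is needed. Keeping both makes the bound
independent of which is larger, so that it can be summed over v and w separately. -/
theorem lintegral_lineAvg_mul_lineAvg_le {v m w : ℝ} (hv : v < m) (hw : m < w) (e e' : E)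
    {g h : E → ℝ≥0∞} (hg : Measurable g) (hh : Measurable h) :
    ∫⁻ x, lineAvg (segmentWeight 1) (e + v • e') g x *
        lineAvg (segmentWeight 1) (e + w • e') h x ∂μ ≤
      ∫⁻ x, 5 * (h x * lineAvg (segmentWeight 2) (e + m • e')
            (lineAvg (poissonWeight |v - m|) e' g) x +
          g x * lineAvg (segmentWeight 2) (e + m • e')
            (lineAvg (poissonWeight |w - m|) e' h) x) ∂μ := by
  have m1 := measurable_segmentWeight 1
  have av : |v - m| = m - v := by rw [abs_sub_comm, abs_of_pos (by linarith)]
  have aw : |w - m| = w - m := abs_of_pos (by linarith)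
  rw [av, aw]
  rcases le_total (w - m) (m - v) with hle | hle
  · calc _ = ∫⁻ x, h x * lineAvg (segmentWeight 1) (e + w • e')
            (lineAvg (segmentWeight 1) (e + v • e') g) x ∂μ := by
          rw [← lintegral_lineAvg_mul m1 (segmentWeight_neg 1) _ hh (measurable_lineAvg m1 _ hg)]
          simp only [mul_comm]
      _ ≤ ∫⁻ x, h x * (5 * lineAvg (segmentWeight 2) (e + m • e')
            (lineAvg (poissonWeight (m - v)) e' g) x) ∂μ := by
          refine lintegral_mono fun x => ?_
          gcongr
          exact lineAvg_comp_le hv.le hw.le (by linarith) (by linarith) (by linarith) e e' hg x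
      _ ≤ _ := by
          refine lintegral_mono fun x => ?_
          rw [mul_left_comm]
          gcongr
          exact le_self_add
  · calc _ = ∫⁻ x, g x * lineAvg (segmentWeight 1) (e + w • e')
            (lineAvg (segmentWeight 1) (e + v • e') h) x ∂μ := by
          rw [lintegral_lineAvg_mul m1 (segmentWeight_neg 1) _ hg (measurable_lineAvg m1 _ hh)]
          simp only [lineAvg_comm m1 m1 (e + w • e') (e + v • e') hh]
      _ ≤ ∫⁻ x, g x * (5 * lineAvg (segmentWeight 2) (e + m • e')
            (lineAvg (poissonWeight (w - m)) e' h) x) ∂μ := by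
          refine lintegral_mono fun x => ?_
          gcongr
          exact lineAvg_comp_le hv.le hw.le (by linarith) (by linarith) (by linarith) e e' hh x
      _ ≤ _ := by
          refine lintegral_mono fun x => ?_
          rw [mul_left_comm]
          gcongr
          exact le_add_self

/-- The interaction of two families of directions separated by the slope `m`. -/
theorem lintegral_sum_mul_sum_le {L R : Finset ℝ} {m : ℝ} (hL : ∀ v ∈ L, v < m)
    (hR : ∀ w ∈ R, m < w) (e e' : E) {h : ℝ → E → ℝ≥0∞} (hh : ∀ v, Measurable (h v)) :
    ∫⁻ x, (∑ v ∈ L, lineAvg (segmentWeight 1) (e + v • e') (h v) x) *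
        (∑ w ∈ R, lineAvg (segmentWeight 1) (e + w • e') (h w) x) ∂μ ≤
      5 * (1 + 32 * 4096) * ∫⁻ x, (∑ v ∈ L, h v x + ∑ w ∈ R, h w x) ^ 2 ∂μ := by
  have disj : Disjoint L R := Finset.disjoint_left.2 fun v hv hv' =>
    lt_asymm (hL v hv) (hR v hv')
  set T : ℝ → E → ℝ≥0∞ := fun v => lineAvg (poissonWeight |v - m|) e' (h v) with hT
  set Q : (E → ℝ≥0∞) → E → ℝ≥0∞ := lineAvg (segmentWeight 2) (e + m • e') with hQ
  have m1 := measurable_segmentWeight 1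
  have m2 := measurable_segmentWeight 2
  have mT : ∀ v, Measurable (T v) := fun v =>
    measurable_lineAvg (measurable_poissonWeight _) e' (hh v)
  have mQ : ∀ v, Measurable (Q (T v)) := fun v => measurable_lineAvg m2 _ (mT v)
  have mA : ∀ v, Measurable (lineAvg (segmentWeight 1) (e + v • e') (h v)) := fun v =>
    measurable_lineAvg m1 _ (hh v)
  set H : E → ℝ≥0∞ := fun x => ∑ v ∈ L ∪ R, h v x with hH
  set G : E → ℝ≥0∞ := fun x => ∑ v ∈ L ∪ R, T v x with hG
  have mH : Measurable H := by fun_prop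
  have mG : Measurable G := by fun_prop
  have HLR : ∀ x, ∑ v ∈ L, h v x + ∑ w ∈ R, h w x = H x := fun x =>
    (Finset.sum_union disj).symm
  simp only [HLR]
  calc _ = ∑ v ∈ L, ∑ w ∈ R, ∫⁻ x, lineAvg (segmentWeight 1) (e + v • e') (h v) x *
          lineAvg (segmentWeight 1) (e + w • e') (h w) x ∂μ := by
        simp only [Finset.sum_mul_sum]
        rw [lintegral_finsetSum _ (fun i _ => by fun_prop)]
        refine Finset.sum_congr rfl fun i _ => ?_
        rw [lintegral_finsetSum _ (fun i _ => by fun_prop)]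
    _ ≤ ∑ v ∈ L, ∑ w ∈ R, ∫⁻ x, 5 * (h w x * Q (T v) x + h v x * Q (T w) x) ∂μ :=
        Finset.sum_le_sum fun v hv => Finset.sum_le_sum fun w hw =>
          lintegral_lineAvg_mul_lineAvg_le (hL v hv) (hR w hw) e e' (hh v) (hh w)
    _ = ∫⁻ x, ∑ v ∈ L, ∑ w ∈ R, 5 * (h w x * Q (T v) x + h v x * Q (T w) x) ∂μ := by
        rw [lintegral_finsetSum _ (fun i _ => by fun_prop)]
        refine Finset.sum_congr rfl fun i _ => ?_
        rw [lintegral_finsetSum _ (fun i _ => by fun_prop)]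
    _ ≤ ∫⁻ x, 5 * (H x * Q G x) ∂μ := by
        refine lintegral_mono fun x => ?_
        have h1 : ∑ v ∈ L, ∑ w ∈ R, h w x * Q (T v) x
            = (∑ w ∈ R, h w x) * ∑ v ∈ L, Q (T v) x := by
          rw [Finset.sum_comm, Finset.sum_mul_sum]
        have h2 : ∑ v ∈ L, ∑ w ∈ R, h v x * Q (T w) x
            = (∑ v ∈ L, h v x) * ∑ w ∈ R, Q (T w) x := by
          rw [Finset.sum_mul_sum]
        have h3 (u : ℝ → ℝ → ℝ≥0∞) :
            ∑ i ∈ L, ∑ j ∈ R, 5 * u i j = 5 * ∑ i ∈ L, ∑ j ∈ R, u i j := by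
          simp only [Finset.mul_sum]
        have h4 : Q G x = ∑ v ∈ L, Q (T v) x + ∑ w ∈ R, Q (T w) x := by
          rw [hQ, lineAvg_finset_sum m2 _ _ mT, Finset.sum_union disj]
        rw [h3 fun v w => h w x * Q (T v) x + h v x * Q (T w) x]
        simp only [Finset.sum_add_distrib, h1, h2]
        rw [h4, ← HLR x]
        gcongr 5 * ?_
        -- Of the four products in H · QG, the two mixed ones are kept.
        rw [add_mul, mul_add, mul_add, add_comm]
        exact add_le_add le_add_self le_self_add
    -- Here Q costs 32 and the Poisson sum 4096, giving the factor 1 + 32 · 4096.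
    _ ≤ ∫⁻ x, 5 * (H x ^ 2 + Q G x ^ 2) ∂μ := by
        refine lintegral_mono fun x => ?_
        gcongr
        exact ENNReal.mul_le_sq_add_sq _ _
    _ = 5 * (∫⁻ x, H x ^ 2 ∂μ + ∫⁻ x, Q G x ^ 2 ∂μ) := by
        rw [lintegral_const_mul' _ _ (by simp), lintegral_add_left (by fun_prop)]
    _ ≤ 5 * (∫⁻ x, H x ^ 2 ∂μ + 32 * (4096 * ∫⁻ x, H x ^ 2 ∂μ)) := by
        gcongr
        refine (lintegral_lineAvg_segmentWeight_two_sq_le _ mG).trans ?_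
        gcongr
        refine lintegral_sum_poisson_sq_le (L ∪ R) (fun v hv => ?_) e' hh
        rcases Finset.mem_union.1 hv with hv | hv
        · exact abs_pos.2 (sub_ne_zero.2 (hL v hv).ne)
        · exact abs_pos.2 (sub_ne_zero.2 (hR v hv).ne')
    _ = _ := by ring

/-! ### Bisection of the set of slopes. -/

theorem Finset.exists_lower_subset {α : Type*} [LinearOrder α] (s : Finset α) {k : ℕ}
    (hk : k ≤ s.card) :
    ∃ l ⊆ s, l.card = k ∧ ∀ x ∈ l, ∀ y ∈ s \ l, x < y := by
  induction k with
  | zero => exact ⟨∅, by simp, by simp, by simp⟩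
  | succ k ih =>
    obtain ⟨l, hl, hc, hlt⟩ := ih (by omega)
    have hne : (s \ l).Nonempty := by
      rw [← Finset.card_pos, Finset.card_sdiff_of_subset hl]; omega
    have hmin := Finset.min'_mem _ hne
    set a := (s \ l).min' hne with ha
    have ha' := Finset.mem_sdiff.1 hmin
    refine ⟨insert a l, Finset.insert_subset ha'.1 hl, by rw [Finset.card_insert_of_notMem ha'.2, hc],
      ?_⟩
    intro x hx y hy
    simp only [Finset.mem_sdiff, Finset.mem_insert, not_or] at hy
    have hy' : y ∈ s \ l := Finset.mem_sdiff.2 ⟨hy.1, hy.2.2⟩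
    rcases Finset.mem_insert.1 hx with rfl | hx
    · exact lt_of_le_of_ne (Finset.min'_le _ _ hy') (Ne.symm hy.2.1)
    · exact hlt x hx y hy'

/-- The dual form of the `L²` bound for `2 ^ n` directions. -/
theorem lintegral_sum_lineAvg_sq_le (n : ℕ) (e e' : E) {h : ℝ → E → ℝ≥0∞}
    (hh : ∀ v, Measurable (h v)) (S : Finset ℝ) (hS : S.card ≤ 2 ^ n) :
    ∫⁻ x, (∑ v ∈ S, lineAvg (segmentWeight 1) (e + v • e') (h v) x) ^ 2 ∂μ ≤
      2000000 * (n + 1) * ∫⁻ x, (∑ v ∈ S, h v x) ^ 2 ∂μ := by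
  induction n generalizing S with
  | zero =>
    rcases Finset.card_le_one_iff_subset_singleton.1 (by simpa using hS) with ⟨v, hv⟩
    rcases Finset.subset_singleton_iff.1 hv with rfl | rfl
    · simp
    · simp only [Finset.sum_singleton]
      refine (lintegral_lineAvg_segmentWeight_one_sq_le _ (hh v)).trans ?_
      gcongr
      norm_num
  | succ n ih =>
    obtain ⟨L, hLS, hLc, hlt⟩ := Finset.exists_lower_subset S (Nat.div_le_self S.card 2)
    have hLc' : L.card ≤ 2 ^ n := by rw [hLc]; rw [pow_succ] at hS; omega
    have hRc' : (S \ L).card ≤ 2 ^ n := by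
      rw [Finset.card_sdiff_of_subset hLS, hLc]; rw [pow_succ] at hS; omega
    obtain ⟨m, hL, hR⟩ := Order.exists_between_finsets L (S \ L) hlt
    set R := S \ L with hRdef
    set A : ℝ → E → ℝ≥0∞ := fun v => lineAvg (segmentWeight 1) (e + v • e') (h v) with hA
    have mA : ∀ v, Measurable (A v) := fun v =>
      measurable_lineAvg (measurable_segmentWeight 1) _ (hh v)
    have split (u : ℝ → E → ℝ≥0∞) (x : E) : ∑ v ∈ S, u v x = ∑ v ∈ L, u v x + ∑ v ∈ R, u v x := by
      rw [add_comm, Finset.sum_sdiff hLS]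
    -- This superadditivity keeps the coefficient n + 1 from doubling: the halves share one copy of
    -- the right side.
    have hsum : ∫⁻ x, (∑ v ∈ L, h v x) ^ 2 ∂μ + ∫⁻ x, (∑ v ∈ R, h v x) ^ 2 ∂μ ≤
        ∫⁻ x, (∑ v ∈ S, h v x) ^ 2 ∂μ := by
      rw [← lintegral_add_left (by fun_prop)]
      refine lintegral_mono fun x => ?_
      rw [split h x, add_sq, add_right_comm]
      exact le_self_add
    have cross := lintegral_sum_mul_sum_le (μ := μ) hL hR e e' hh
    simp only [← split h] at cross
    calc ∫⁻ x, (∑ v ∈ S, A v x) ^ 2 ∂μ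
        = ∫⁻ x, ((∑ v ∈ L, A v x) ^ 2 + (∑ v ∈ R, A v x) ^ 2 +
            2 * ((∑ v ∈ L, A v x) * (∑ v ∈ R, A v x))) ∂μ := by
          refine lintegral_congr fun x => ?_
          rw [split A x]; ring
      _ = ∫⁻ x, (∑ v ∈ L, A v x) ^ 2 ∂μ + ∫⁻ x, (∑ v ∈ R, A v x) ^ 2 ∂μ +
            2 * ∫⁻ x, (∑ v ∈ L, A v x) * (∑ v ∈ R, A v x) ∂μ := by
          rw [lintegral_add_left (by fun_prop), lintegral_add_left (by fun_prop),
            lintegral_const_mul _ (by fun_prop)]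
      _ ≤ 2000000 * (n + 1) * ∫⁻ x, (∑ v ∈ L, h v x) ^ 2 ∂μ +
            2000000 * (n + 1) * ∫⁻ x, (∑ v ∈ R, h v x) ^ 2 ∂μ +
            2 * (5 * (1 + 32 * 4096) * ∫⁻ x, (∑ v ∈ S, h v x) ^ 2 ∂μ) := by
          gcongr
          · exact ih L hLc'
          · exact ih R hRc'
      -- The cross term costs 2 · 5 · (1 + 32 · 4096) = 1310730, within the 2000000 available per
      -- bisection.
      _ ≤ 2000000 * (n + 1) * ∫⁻ x, (∑ v ∈ S, h v x) ^ 2 ∂μ +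
            2000000 * ∫⁻ x, (∑ v ∈ S, h v x) ^ 2 ∂μ := by
          rw [← mul_add, ← mul_assoc 2]
          gcongr
          norm_num
      _ = _ := by push_cast; ring

end Directions

/-! ### Duality: from the sum estimate to the maximal function. -/

section Maximal

variable {E : Type*} [NormedAddCommGroup E] [NormedSpace ℝ E] [MeasurableSpace E] [BorelSpace E]
  [SecondCountableTopology E] {μ : Measure E} [SFinite μ] [μ.IsAddRightInvariant]

/-- The `L²` bound for the maximal average over `2 ^ n` directions `e + v • e'`. -/
theorem lintegral_iSup_lineAvg_sq_le (n : ℕ) (e e' : E) {g : E → ℝ≥0∞} (hg : Measurable g)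
    (S : Finset ℝ) (hS : S.card ≤ 2 ^ n) :
    ∫⁻ x, (⨆ v ∈ S, lineAvg (segmentWeight 1) (e + v • e') g x) ^ 2 ∂μ ≤
      4 * (2000000 * (n + 1)) * ∫⁻ x, g x ^ 2 ∂μ := by
  rcases S.eq_empty_or_nonempty with rfl | hne
  · simp
  rcases eq_or_ne (∫⁻ x, g x ^ 2 ∂μ) ∞ with hinf | hfin
  · rw [hinf, ENNReal.mul_top (by simp)]; exact le_top
  set A : ℝ → E → ℝ≥0∞ := fun v => lineAvg (segmentWeight 1) (e + v • e') g with hA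
  have m1 := measurable_segmentWeight 1
  have mA : ∀ v, Measurable (A v) := fun v => measurable_lineAvg m1 _ hg
  set M : E → ℝ≥0∞ := fun x => ⨆ v ∈ S, A v x with hM
  have mM : Measurable M := Measurable.biSup _ S.countable_toSet fun v _ => mA v
  have attained : ∀ x, ∃ v ∈ S, A v x = M x := by
    intro x
    obtain ⟨v, hv, h⟩ := Finset.exists_mem_eq_sup S hne fun v => A v x
    exact ⟨v, hv, by rw [← h, Finset.sup_eq_iSup]⟩
  set D : ℝ → Set E := fun v => {x | A v x = M x} with hD
  have mD : ∀ v, MeasurableSet (D v) := fun v => measurableSet_eq_fun (mA v) mM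
  -- The number of slopes attaining the maximum at x. Dividing by it shares ties equally, so the
  -- linearization needs no measurable selection.
  set c : E → ℝ≥0∞ := fun x => ∑ v ∈ S, (D v).indicator 1 x with hc
  have mind : ∀ v, Measurable ((D v).indicator (1 : E → ℝ≥0∞)) := fun v =>
    measurable_one.indicator (mD v)
  have mc : Measurable c := by fun_prop
  have hc0 : ∀ x, c x ≠ 0 := by
    intro x h
    obtain ⟨v, hv, hx⟩ := attained x
    have := (Finset.sum_eq_zero_iff.1 h) v hv
    simp [hD, hx] at this
  have hctop : ∀ x, c x ≠ ∞ := by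
    intro x
    refine (ENNReal.sum_lt_top.2 fun v _ => ?_).ne
    by_cases hx : x ∈ D v <;> simp [hx]
  set h : ℝ → E → ℝ≥0∞ := fun v x => M x * ((D v).indicator 1 x / c x) with hh
  have mh : ∀ v, Measurable (h v) := fun v => by have := mind v; fun_prop
  have hsum : ∀ x, ∑ v ∈ S, h v x = M x := by
    intro x
    simp only [hh, ← Finset.mul_sum, div_eq_mul_inv, ← Finset.sum_mul]
    rw [ENNReal.mul_inv_cancel (hc0 x) (hctop x), mul_one]
  have hAsum : ∀ x, ∑ v ∈ S, A v x * h v x = M x ^ 2 := by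
    intro x
    rw [sq, ← hsum x, Finset.sum_mul, hsum x]
    refine Finset.sum_congr rfl fun v _ => ?_
    by_cases hx : x ∈ D v
    · rw [show A v x = M x from hx, mul_comm]
    · simp [hh, hx]
  set F : E → ℝ≥0∞ := fun x => ∑ v ∈ S, lineAvg (segmentWeight 1) (e + v • e') (h v) x with hF
  have mL : ∀ v, Measurable (lineAvg (segmentWeight 1) (e + v • e') (h v)) := fun v =>
    measurable_lineAvg m1 _ (mh v)
  have mF : Measurable F := by fun_prop
  have dual : ∫⁻ x, M x ^ 2 ∂μ = ∫⁻ x, g x * F x ∂μ := by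
    simp only [← hAsum, hF, Finset.mul_sum]
    rw [lintegral_finsetSum _ (fun v _ => by fun_prop),
      lintegral_finsetSum _ (fun v _ => by fun_prop)]
    refine Finset.sum_congr rfl fun v _ => ?_
    exact lintegral_lineAvg_mul m1 (segmentWeight_neg 1) _ hg (mh v)
  -- Again only qualitative: bounding M² by the sum over all slopes permits the final cancellation.
  have Mfin : ∫⁻ x, M x ^ 2 ∂μ ≠ ∞ := by
    refine ne_top_of_le_ne_top ?_ (lintegral_mono (g := fun x => ∑ v ∈ S, A v x ^ 2) fun x => ?_)
    · rw [lintegral_finsetSum _ (fun v _ => by fun_prop)]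
      refine (ENNReal.sum_lt_top.2 fun v _ => ?_).ne
      exact (lintegral_lineAvg_segmentWeight_one_sq_le _ hg).trans_lt
        (ENNReal.mul_lt_top (by simp) hfin.lt_top)
    · obtain ⟨v, hv, hx⟩ := attained x
      simp only [← hx]
      exact Finset.single_le_sum (f := fun v => A v x ^ 2) (fun _ _ => zero_le) hv
  have bound := lintegral_sum_lineAvg_sq_le (μ := μ) n e e' mh S hS
  simp only [hsum] at bound
  set K : ℝ≥0∞ := 2000000 * (n + 1) with hK
  have K0 : K ≠ 0 := by simp [hK]
  have Ktop : K ≠ ∞ := by simp [hK, ENNReal.mul_eq_top]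
  -- The weights in 2K g F ≤ (2K g)² + F² are chosen so that ∫ F² ≤ K ∫ M² can be absorbed after
  -- dividing by K.
  have final : K * (∫⁻ x, M x ^ 2 ∂μ + ∫⁻ x, M x ^ 2 ∂μ) ≤
      K * (∫⁻ x, M x ^ 2 ∂μ + 4 * K * ∫⁻ x, g x ^ 2 ∂μ) := by
    calc K * (∫⁻ x, M x ^ 2 ∂μ + ∫⁻ x, M x ^ 2 ∂μ)
        = ∫⁻ x, 2 * K * g x * F x ∂μ := by
          rw [dual, ← two_mul, ← mul_assoc, mul_comm K, ← lintegral_const_mul _ (by fun_prop)]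
          simp only [mul_assoc]
      _ ≤ ∫⁻ x, ((2 * K) ^ 2 * g x ^ 2 + F x ^ 2) ∂μ := by
          refine lintegral_mono fun x => (ENNReal.mul_le_sq_add_sq _ _).trans_eq ?_
          ring
      _ = (2 * K) ^ 2 * ∫⁻ x, g x ^ 2 ∂μ + ∫⁻ x, F x ^ 2 ∂μ := by
          rw [lintegral_add_left (by fun_prop), lintegral_const_mul _ (by fun_prop)]
      _ ≤ (2 * K) ^ 2 * ∫⁻ x, g x ^ 2 ∂μ + K * ∫⁻ x, M x ^ 2 ∂μ := by gcongr
      _ = _ := by ring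
  rw [ENNReal.mul_le_mul_iff_right K0 Ktop, ENNReal.add_le_add_iff_left Mfin] at final
  exact final

end Maximal

/-! ### From unit vectors in the plane to slopes. -/

section Plane

/-- The shortened segment lies inside the full one, and rescaling costs 1/|c| ≤ 2. The sign of c is
removed by the reflection t ↦ -t. -/
theorem lineAvg_segmentWeight_smul_le {E : Type*} [NormedAddCommGroup E] [NormedSpace ℝ E]
    {c : ℝ} (h1 : 1 / 2 ≤ |c|) (h2 : |c| ≤ 1) (e : E) (g : E → ℝ≥0∞) (x : E) :
    lineAvg (segmentWeight 1) (c • e) g x ≤ 2 * lineAvg (segmentWeight 1) e g x := by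
  have hc : 0 < |c| := by linarith
  have pos : lineAvg (segmentWeight 1) (|c| • e) g x ≤ 2 * lineAvg (segmentWeight 1) e g x := by
    unfold lineAvg
    rw [← lintegral_comp_affine hc 0 fun t => segmentWeight 1 t * g (x + t • e), ← lintegral_const_mul' _ _ (by simp)]
    refine lintegral_mono fun t => ?_
    by_cases ht : t ∈ Set.Ioo (-1 : ℝ) 1
    swap
    · simp [segmentWeight, ht]
    have ht' : t * |c| ∈ Set.Ioo (-1 : ℝ) 1 := by
      rw [Set.mem_Ioo, ← abs_lt] at *
      rw [abs_mul, abs_abs]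
      nlinarith [abs_nonneg t]
    simp only [segmentWeight, zero_add, ht, ht', Set.indicator_of_mem, Pi.one_apply, one_mul,
      smul_smul]
    rw [← mul_assoc]
    refine le_mul_of_one_le_left' ?_
    rw [← ENNReal.ofReal_ofNat 2, ← ENNReal.ofReal_mul (by norm_num), ← ENNReal.ofReal_one]
    exact ENNReal.ofReal_le_ofReal (by linarith)
  rcases abs_choice c with h | h
  · rwa [h] at pos
  · refine le_of_eq_of_le ?_ pos
    rw [h]
    unfold lineAvg
    rw [← lintegral_neg_eq_self]
    simp [segmentWeight_neg]

/-- Unit vectors that are close to the axis `i`, up to sign, contribute at most the maximal average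
over the corresponding slopes. -/
theorem lintegral_iSup_lineAvg_unit_sq_le (n : ℕ) (S : Finset (EuclideanSpace ℝ (Fin 2)))
    (hS : S.card ≤ 2 ^ n) {i j : Fin 2} (hij : i ≠ j) (hunit : ∀ v ∈ S, ‖v‖ = 1)
    (hax : ∀ v ∈ S, |v j| ≤ |v i|) {g : EuclideanSpace ℝ (Fin 2) → ℝ≥0∞} (hg : Measurable g) :
    ∫⁻ x, (⨆ v ∈ S, lineAvg (segmentWeight 1) v g x) ^ 2 ≤
      32000000 * (n + 1) * ∫⁻ x, g x ^ 2 := by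
  set e : EuclideanSpace ℝ (Fin 2) := EuclideanSpace.single i 1
  set e' : EuclideanSpace ℝ (Fin 2) := EuclideanSpace.single j 1
  set T : Finset ℝ := S.image fun v => v j / v i
  have hT : T.card ≤ 2 ^ n := Finset.card_image_le.trans hS
  have le (x) : ⨆ v ∈ S, lineAvg (segmentWeight 1) v g x ≤
      2 * ⨆ m ∈ T, lineAvg (segmentWeight 1) (e + m • e') g x := by
    refine iSup₂_le fun v hv => ?_
    have hsq : v i ^ 2 + v j ^ 2 = 1 := by
      have := EuclideanSpace.real_norm_sq_eq v
      rw [hunit v hv, Fin.sum_univ_two] at this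
      fin_cases i <;> fin_cases j <;> simp at hij ⊢ <;> linarith
    have hle : v j ^ 2 ≤ v i ^ 2 := sq_le_sq.2 (hax v hv)
    have hi1 : |v i| ≤ 1 := by
      rw [← sq_le_one_iff_abs_le_one]; nlinarith [sq_nonneg (v j)]
    have hi2 : 1 / 2 ≤ |v i| := by
      by_contra! hlt
      nlinarith [abs_nonneg (v i), sq_abs (v i)]
    have hi0 : v i ≠ 0 := by
      intro h; rw [h] at hi2; norm_num at hi2
    have hv' : v = v i • (e + (v j / v i) • e') := by
      ext k
      have hk : k = i ∨ k = j := by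
        fin_cases i <;> fin_cases j <;> fin_cases k <;> simp at hij ⊢
      rcases hk with rfl | rfl
      · simp [e, e', hij]
      · simp [e, e', hij.symm]
        field_simp
    calc lineAvg (segmentWeight 1) v g x
        = lineAvg (segmentWeight 1) (v i • (e + (v j / v i) • e')) g x := by rw [← hv']
      _ ≤ 2 * lineAvg (segmentWeight 1) (e + (v j / v i) • e') g x :=
          lineAvg_segmentWeight_smul_le hi2 hi1 _ g x
      _ ≤ _ := by
          gcongr
          exact le_iSup₂ (f := fun m (_ : m ∈ T) => lineAvg (segmentWeight 1) (e + m • e') g x)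
            (v j / v i) (Finset.mem_image_of_mem _ hv)
  calc _ ≤ ∫⁻ x, 4 * (⨆ m ∈ T, lineAvg (segmentWeight 1) (e + m • e') g x) ^ 2 := by
        refine lintegral_mono fun x => ?_
        calc _ ≤ (2 * ⨆ m ∈ T, lineAvg (segmentWeight 1) (e + m • e') g x) ^ 2 := by
              gcongr; exact le x
          _ = _ := by rw [mul_pow]; norm_num
    _ = 4 * ∫⁻ x, (⨆ m ∈ T, lineAvg (segmentWeight 1) (e + m • e') g x) ^ 2 :=
        lintegral_const_mul' _ _ (by simp)
    _ ≤ 4 * (4 * (2000000 * (n + 1)) * ∫⁻ x, g x ^ 2) := by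
        gcongr
        exact lintegral_iSup_lineAvg_sq_le n e e' hg T hT
    _ = _ := by ring

theorem lintegral_iSup_lineAvg_unit_vectors_sq_le (n : ℕ)
    (S : Finset (EuclideanSpace ℝ (Fin 2))) (hS : S.card ≤ 2 ^ n) (hunit : ∀ v ∈ S, ‖v‖ = 1)
    {g : EuclideanSpace ℝ (Fin 2) → ℝ≥0∞} (hg : Measurable g) :
    ∫⁻ x, (⨆ v ∈ S, lineAvg (segmentWeight 1) v g x) ^ 2 ≤
      64000000 * (n + 1) * ∫⁻ x, g x ^ 2 := by
  classical
  set S₀ := S.filter fun v => |v 1| ≤ |v 0|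
  set S₁ := S.filter fun v => |v 0| ≤ |v 1|
  have c₀ : S₀.card ≤ 2 ^ n := (Finset.card_filter_le _ _).trans hS
  have c₁ : S₁.card ≤ 2 ^ n := (Finset.card_filter_le _ _).trans hS
  have mS (S' : Finset (EuclideanSpace ℝ (Fin 2))) :
      Measurable fun x => ⨆ v ∈ S', lineAvg (segmentWeight 1) v g x :=
    Measurable.biSup _ S'.countable_toSet fun v _ =>
      measurable_lineAvg (measurable_segmentWeight 1) v hg
  have b₀ := lintegral_iSup_lineAvg_unit_sq_le n S₀ c₀ (i := 0) (j := 1) (by simp)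
    (fun v hv => hunit v (Finset.mem_filter.1 hv).1) (fun v hv => (Finset.mem_filter.1 hv).2) hg
  have b₁ := lintegral_iSup_lineAvg_unit_sq_le n S₁ c₁ (i := 1) (j := 0) (by simp)
    (fun v hv => hunit v (Finset.mem_filter.1 hv).1) (fun v hv => (Finset.mem_filter.1 hv).2) hg
  have hU : S = S₀ ∪ S₁ := by
    ext v
    simp only [S₀, S₁, Finset.mem_union, Finset.mem_filter, ← and_or_left]
    exact ⟨fun h => ⟨h, le_total _ _⟩, fun h => h.1⟩
  calc _ ≤ ∫⁻ x, ((⨆ v ∈ S₀, lineAvg (segmentWeight 1) v g x) ^ 2 +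
          (⨆ v ∈ S₁, lineAvg (segmentWeight 1) v g x) ^ 2) := by
        refine lintegral_mono fun x => ?_
        rw [hU, Finset.iSup_union]
        rcases le_total (⨆ v ∈ S₀, lineAvg (segmentWeight 1) v g x)
          (⨆ v ∈ S₁, lineAvg (segmentWeight 1) v g x) with h | h
        · rw [sup_eq_right.2 h]; exact le_add_self
        · rw [sup_eq_left.2 h]; exact le_self_add
    _ = _ := lintegral_add_left ((mS S₀).pow_const 2) _
    _ ≤ _ := add_le_add b₀ b₁
    _ = _ := by ring

end Plane

/-! ### Null sets, measurability and the final constant. -/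

theorem natLog_add_two_le {N : ℕ} (hN : 2 ≤ N) :
    (Nat.log 2 N : ℝ) + 2 ≤ 6 * Real.log N := by
  have h2 : (1 : ℝ) / 2 ≤ Real.log 2 := by linarith [Real.log_two_gt_d9]
  have hN' : Real.log 2 ≤ Real.log N :=
    Real.log_le_log (by norm_num) (by exact_mod_cast hN)
  have hpow : (Nat.log 2 N : ℝ) * Real.log 2 ≤ Real.log N := by
    rw [← Real.log_pow]
    refine Real.log_le_log (by positivity) ?_
    exact_mod_cast Nat.pow_log_le_self 2 (by omega)
  nlinarith [(Nat.cast_nonneg (Nat.log 2 N) : (0 : ℝ) ≤ _)]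

theorem lineAvg_segmentWeight_one_eq {E : Type*} [NormedAddCommGroup E] [NormedSpace ℝ E]
    (e : E) (g : E → ℝ≥0∞) (x : E) :
    lineAvg (segmentWeight 1) e g x = ∫⁻ t in Set.Ioo (-1 : ℝ) 1, g (x + t • e) := by
  rw [lineAvg, ← lintegral_indicator measurableSet_Ioo]
  refine lintegral_congr fun t => ?_
  by_cases ht : t ∈ Set.Ioo (-1 : ℝ) 1 <;> simp [segmentWeight, ht]

/-- The L² bound applied to the indicator of a measurable null superset of the exceptional set shows
that its segment averages vanish almost everywhere. This allows `f` to be replaced by a strongly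
measurable representative on almost every segment. -/
theorem ae_ae_comp_line {E : Type*} [NormedAddCommGroup E] [NormedSpace ℝ E] [MeasurableSpace E]
    [BorelSpace E] [SecondCountableTopology E] {μ : Measure E} [SFinite μ]
    [μ.IsAddRightInvariant] {p : E → Prop} (hp : ∀ᵐ x ∂μ, p x) (e : E) :
    ∀ᵐ x ∂μ, ∀ᵐ t ∂(volume.restrict (Set.Ioo (-1 : ℝ) 1)), p (x + t • e) := by
  set B := toMeasurable μ {x | ¬ p x}
  have mB : MeasurableSet B := measurableSet_toMeasurable _ _
  have hB : μ B = 0 := by rw [measure_toMeasurable]; exact hp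
  have mg : Measurable (B.indicator (1 : E → ℝ≥0∞)) := measurable_one.indicator mB
  have h0 : ∫⁻ x, lineAvg (segmentWeight 1) e (B.indicator 1) x ^ 2 ∂μ = 0 := by
    refine le_antisymm ((lintegral_lineAvg_segmentWeight_one_sq_le e mg).trans ?_) zero_le
    have : ∀ x, B.indicator (1 : E → ℝ≥0∞) x ^ 2 = B.indicator 1 x := by
      intro x; by_cases hx : x ∈ B <;> simp [hx]
    simp only [this]
    rw [lintegral_indicator_one mB, hB, mul_zero]
  rw [lintegral_eq_zero_iff ((measurable_lineAvg (measurable_segmentWeight 1) e mg).pow_const 2)]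
    at h0
  filter_upwards [h0] with x hx
  have hx' : lineAvg (segmentWeight 1) e (B.indicator 1) x = 0 := by simpa using hx
  rw [lineAvg_segmentWeight_one_eq, lintegral_eq_zero_iff (by fun_prop)] at hx'
  filter_upwards [hx'] with t ht
  by_contra hcon
  have : x + t • e ∈ B := subset_toMeasurable _ _ hcon
  simp [this] at ht

theorem measurable_singleScaleKakeya (S : Finset (EuclideanSpace ℝ (Fin 2)))
    {f : EuclideanSpace ℝ (Fin 2) → ℂ} (hf : StronglyMeasurable f) :
    Measurable (singleScaleKakeya S f) := by
  unfold singleScaleKakeya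
  refine Measurable.iSup fun v => ?_
  refine StronglyMeasurable.measurable (StronglyMeasurable.norm ?_)
  refine StronglyMeasurable.integral_prod_right
    (f := fun (x : EuclideanSpace ℝ (Fin 2)) (t : ℝ) =>
      f (x + t • (v : EuclideanSpace ℝ (Fin 2)))) ?_
  exact hf.comp_measurable (by fun_prop)

theorem enorm_singleScaleKakeya_le (S : Finset (EuclideanSpace ℝ (Fin 2)))
    (f : EuclideanSpace ℝ (Fin 2) → ℂ) (x : EuclideanSpace ℝ (Fin 2)) :
    ‖singleScaleKakeya S f x‖ₑ ≤
      ⨆ v ∈ S, lineAvg (segmentWeight 1) v (fun y => ‖f y‖ₑ) x := by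
  unfold singleScaleKakeya
  rcases S.eq_empty_or_nonempty with rfl | ⟨u, hu⟩
  · simp
  have : Nonempty {v // v ∈ S} := ⟨⟨u, hu⟩⟩
  obtain ⟨v, hv⟩ := exists_eq_ciSup_of_finite (f := fun v : {v // v ∈ S} =>
    ‖∫ t in Set.Ioo (-1 : ℝ) 1, f (x + t • (v : EuclideanSpace ℝ (Fin 2)))‖)
  rw [← hv, enorm_norm]
  refine (enorm_integral_le_lintegral_enorm _).trans ?_
  rw [← lineAvg_segmentWeight_one_eq (v : EuclideanSpace ℝ (Fin 2)) (fun y => ‖f y‖ₑ)]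
  exact le_iSup₂ (f := fun w (_ : w ∈ S) =>
    lineAvg (segmentWeight 1) w (fun y => ‖f y‖ₑ) x) v.1 v.2

theorem eLpNorm_two_eq {α F : Type*} [MeasurableSpace α] [NormedAddCommGroup F] (μ : Measure α)
    (f : α → F) : eLpNorm f 2 μ = (∫⁻ x, ‖f x‖ₑ ^ 2 ∂μ) ^ (1 / 2 : ℝ) := by
  rw [eLpNorm_eq_lintegral_rpow_enorm_toReal (by simp) (by simp)]
  simp

theorem theorem3 :
    ∃ C : ℝ, 0 < C ∧
      ∀ (N : ℕ), 2 ≤ N →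
      ∀ (S : Finset (EuclideanSpace ℝ (Fin 2))), S.card = N → (∀ v ∈ S, ‖v‖ = 1) →
      ∀ (f : EuclideanSpace ℝ (Fin 2) → ℂ), MemLp f 2 volume →
        (∀ᵐ x : EuclideanSpace ℝ (Fin 2), ∀ v ∈ S,
          IntegrableOn (fun t : ℝ => f (x + t • v)) (Set.Ioo (-1 : ℝ) 1) volume) ∧
        MemLp (singleScaleKakeya S f) 2 volume ∧
        eLpNorm (singleScaleKakeya S f) 2 volume ≤
          ENNReal.ofReal (C * Real.sqrt (Real.log (N : ℝ))) * eLpNorm f 2 volume := by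
  -- 20000² = 4 · 10⁸ exceeds 64000000 · 6, the product of the planar constant and the factor in
  -- `natLog_add_two_le`.
  refine ⟨20000, by norm_num, fun N hN S hSN hunit f hf => ?_⟩
  set f' := hf.1.mk f
  have hff' : f =ᵐ[volume] f' := hf.1.ae_eq_mk
  have mf' : StronglyMeasurable f' := hf.1.stronglyMeasurable_mk
  have mg : Measurable fun x => ‖f' x‖ₑ := mf'.enorm
  have hf' : MemLp f' 2 volume := (memLp_congr_ae hff').1 hf
  have hfin : ∫⁻ x, ‖f' x‖ₑ ^ 2 < ∞ := by
    have := (eLpNorm_lt_top_iff_lintegral_rpow_enorm_lt_top (by simp) (by simp)).1 hf'.2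
    simpa using this
  have hlines : ∀ᵐ x : EuclideanSpace ℝ (Fin 2), ∀ v ∈ S,
      ∀ᵐ t ∂(volume.restrict (Set.Ioo (-1 : ℝ) 1)), f (x + t • v) = f' (x + t • v) :=
    (Finset.eventually_all S).2 fun v _ => ae_ae_comp_line hff' v
  have hint : ∀ᵐ x : EuclideanSpace ℝ (Fin 2), ∀ v ∈ S,
      lineAvg (segmentWeight 1) v (fun y => ‖f' y‖ₑ) x < ∞ := by
    refine (Finset.eventually_all S).2 fun v _ => ?_
    have h := (lintegral_lineAvg_segmentWeight_one_sq_le (μ := volume) v mg).trans_lt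
      (ENNReal.mul_lt_top (by simp) hfin)
    filter_upwards [ae_lt_top
      ((measurable_lineAvg (measurable_segmentWeight 1) v mg).pow_const 2) h.ne] with x hx
    by_contra hcon
    rw [not_lt, top_le_iff] at hcon
    simp [hcon] at hx
  have hKK : singleScaleKakeya S f =ᵐ[volume] singleScaleKakeya S f' := by
    filter_upwards [hlines] with x hx
    unfold singleScaleKakeya
    congr 1
    funext v
    rw [integral_congr_ae (hx v.1 v.2)]
  have hbound : eLpNorm (singleScaleKakeya S f) 2 volume ≤
      ENNReal.ofReal (20000 * Real.sqrt (Real.log (N : ℝ))) * eLpNorm f 2 volume := by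
    set n := Nat.log 2 N + 1 with hn
    have hcard : S.card ≤ 2 ^ n := by
      rw [hSN]; exact (Nat.lt_pow_succ_log_self (by norm_num) N).le
    have hlog : 0 ≤ Real.log N := Real.log_natCast_nonneg N
    have hconst : (64000000 * (n + 1) : ℝ≥0∞) ≤
        ENNReal.ofReal (20000 * Real.sqrt (Real.log (N : ℝ))) ^ 2 := by
      rw [← ENNReal.ofReal_pow (by positivity), mul_pow, Real.sq_sqrt hlog]
      have : (64000000 * (n + 1) : ℝ≥0∞) = ENNReal.ofReal (64000000 * (n + 1)) := by
        rw [ENNReal.ofReal_mul (by norm_num), ENNReal.ofReal_add (by positivity) (by norm_num)]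
        simp
      rw [this]
      apply ENNReal.ofReal_le_ofReal
      have := natLog_add_two_le hN
      rw [hn]
      push_cast
      nlinarith
    rw [eLpNorm_congr_ae hKK, eLpNorm_congr_ae hff', eLpNorm_two_eq, eLpNorm_two_eq]
    calc (∫⁻ x, ‖singleScaleKakeya S f' x‖ₑ ^ 2) ^ (1 / 2 : ℝ)
        ≤ (∫⁻ x, (⨆ v ∈ S, lineAvg (segmentWeight 1) v (fun y => ‖f' y‖ₑ) x) ^ 2)
            ^ (1 / 2 : ℝ) := by
          gcongr with x
          exact enorm_singleScaleKakeya_le S f' x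
      _ ≤ (64000000 * (n + 1) * ∫⁻ x, ‖f' x‖ₑ ^ 2) ^ (1 / 2 : ℝ) := by
          gcongr
          exact lintegral_iSup_lineAvg_unit_vectors_sq_le n S hcard hunit mg
      _ ≤ (ENNReal.ofReal (20000 * Real.sqrt (Real.log (N : ℝ))) ^ 2 *
            ∫⁻ x, ‖f' x‖ₑ ^ 2) ^ (1 / 2 : ℝ) := by gcongr
      _ = _ := by
          rw [ENNReal.mul_rpow_of_nonneg _ _ (by norm_num), ← ENNReal.rpow_natCast,
            ← ENNReal.rpow_mul]
          norm_num
  refine ⟨?_, ⟨?_, hbound.trans_lt (ENNReal.mul_lt_top ENNReal.ofReal_lt_top hf.2)⟩, hbound⟩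
  · filter_upwards [hlines, hint] with x hx hx' v hv
    refine Integrable.congr (f := fun t => f' (x + t • v)) ⟨?_, ?_⟩ ?_
    · exact (mf'.comp_measurable (by fun_prop)).aestronglyMeasurable
    · rw [hasFiniteIntegral_iff_enorm]
      rw [← lineAvg_segmentWeight_one_eq v (fun y => ‖f' y‖ₑ)]
      exact hx' v hv
    · filter_upwards [hx v hv] with t ht using ht.symm
  · exact (measurable_singleScaleKakeya S mf').aestronglyMeasurable.congr hKK.symm
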